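/- **Setting.** A tensor network is a (hyper)graph whose vertices are dense tensors and whose edges $e$ are tensor dimensions of size $\dim e\ge 1$; put $w(e)=\log\dim e$. For disjoint vertex sets $A,B$ let $\mathrm{cut}(A)$ be the total weight of the dimensions of the tensor obtained by contracting $A$, and let $\mathrm{cut}(A,B)$ be the total weight of the edges adjacent to both $A$ and $B$. The contraction $(A,B)$ costs $\exp(\mathrm{cut}(A)+\mathrm{cut}(B)-\mathrm{cut}(A,B))$, and the cost of a contraction tree is the sum of the costs of its contractions. *Data.* Let $N\ge 3$ and let $m<R<s$ be positive integers. The data $G_D$ is a tensor train with cores $v_1,\dots,v_N$: consecutive cores are joined by an edge of size $R$, and each core has one uncontracted edge of size $s$. The $N-1$ uncontracted edges at $v_1,\dots,v_{N-1}$ are to be sketched. The data contraction tree $T_0$ contracts from left to right, $(\cdots((v_1,v_2),v_3),\dots,v_N)$. *Embeddings.* An embedding $G_E$ is a tensor network on a graph, with $N_E$ vertices, attached to the data along the edges to be sketched. For an ordering (linearization) of its vertices, the row size at a vertex is the product of the sizes of the output edges at that vertex and of the embedding edges joining it to later vertices. Let $0<\epsilon,\delta<1$ and fix constants $c_0,C_1>0$.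 The embedding is *admissible* with sketch size $m$ if - for some ordering every row size is at least $c_0N_E\log(1/\delta)/\epsilon^2$ (the $(\epsilon,\delta)$-accurate sufficient condition), and - it has exactly one output edge, of size $m$, where $c_0N_E\log(1/\delta)/\epsilon^2\le m\le C_1N_E\log(1/\delta)/\epsilon^2$. A contraction tree $T_B$ of the whole network $(G_D,G_E)$ is *constrained on $T_0$* if for each contraction $(A,B)$ of $T_0$ there is a contraction $(\hat A,\hat B)$ of $T_B$ with $\hat A\cap V_D=A$ and $\hat B\cap V_D=B$ (the two operands of a contraction being unordered). *Randomize-then-Orthogonalize sketch.* The embedding is the tensor train with cores $u_1,\dots,u_{N-1}$, where $u_j$ is attached to $v_j$ by the sketched edge, consecutive cores are joined by an edge of size $m$, and $u_{N-1}$ carries the output edge of size $m$. The running tensor is contracted successively in the order $v_1,u_1,v_2,u_2,\dots,v_{N-1},u_{N-1},v_N$. **Theorem.** 1. For all $c_0,C_1>0$ there is a constant $c>0$, depending only on $c_0,C_1$, such that for all $N\ge 3$, $m<R<s$ and $\epsilon,\delta\in(0,1)$, every admissible embedding with sketch size $m$ and every contraction tree $T_B$ constrained on $T_0$, the cost of $T_B$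 is at least $c\,NsR^2m$; that is, it is $\Omega(NsR^2m)$. 2. The contraction tree of the Randomize-then-Orthogonalize sketch is constrained on $T_0$ and its cost is $\Theta(NsR^2m)$, with absolute constants. 3. Its embedding, which has $N_E=N-1$ vertices, is admissible for all $c_0,C_1>0$ and all $m$ with $c_0N_E\log(1/\delta)/\epsilon^2\le m\le C_1N_E\log(1/\delta)/\epsilon^2$. 4. Hence the Randomize-then-Orthogonalize sketch is asymptotically optimal: for all $c_0,C_1>0$ there is a constant $K$, depending only on $c_0,C_1$, such that its cost is at most $K$ times the cost of any contraction tree constrained on $T_0$ with any admissible embedding with the same $N,s,R,m$. -/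

import Mathlib

universe u v

namespace TNSketch

/-- A tensor network on a hypergraph: `V` indexes the tensors, `E` the (hyper)edges.  An edge is
adjacent to the vertices in `ends e`; it is uncontracted when it also has a dangling end, and a
contracted edge is adjacent to at least two vertices.  `dim e` is the dimension size of `e`. -/
structure TensorNetwork (V : Type*) (E : Type*) where
  ends : E → Finset V
  dangling : E → Prop
  dim : E → ℕ+
  ends_nonempty : ∀ e, (ends e).Nonempty
  two_le_of_contracted : ∀ e, ¬ dangling e → 2 ≤ (ends e).card

namespace TensorNetwork

variable {V E : Type*} [Fintype V] [Fintype E]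

/-- `w(e)`, the natural logarithm of the dimension size. -/
noncomputable def weight (G : TensorNetwork V E) (e : E) : ℝ := Real.log ((G.dim e : ℕ) : ℝ)

open Classical in
/-- `E(A, B)`: the edges adjacent both to `A` and to `B`. -/
noncomputable def edgesBetween (G : TensorNetwork V E) (A B : Finset V) : Finset E :=
  {e | (∃ a ∈ A, a ∈ G.ends e) ∧ (∃ b ∈ B, b ∈ G.ends e)}

open Classical in
/-- `E(A, *)`: the uncontracted edges adjacent to vertices of `A` only. -/
noncomputable def edgesOpen (G : TensorNetwork V E) (A : Finset V) : Finset E :=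
  {e | G.dangling e ∧ G.ends e ⊆ A}

open Classical in
/-- `E(A) = E(A, V \ A) ∪ E(A, *)`: the dimensions of the tensor obtained by contracting `A`. -/
noncomputable def edgesOut (G : TensorNetwork V E) (A : Finset V) : Finset E :=
  G.edgesBetween A Aᶜ ∪ G.edgesOpen A

noncomputable def cutBetween (G : TensorNetwork V E) (A B : Finset V) : ℝ :=
  ∑ e ∈ G.edgesBetween A B, G.weight e

noncomputable def cut (G : TensorNetwork V E) (A : Finset V) : ℝ :=
  ∑ e ∈ G.edgesOut A, G.weight e

/-- Logarithm of the cost of contracting the dense tensors obtained from the disjoint sets `A` and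
`B` by classical matrix multiplication. -/
noncomputable def logCost (G : TensorNetwork V E) (A B : Finset V) : ℝ :=
  G.cut A + G.cut B - G.cutBetween A B

/-- The network is a graph: uncontracted edges are adjacent to one vertex, contracted edges to
two. -/
def IsGraph (G : TensorNetwork V E) : Prop :=
  ∀ e, (G.dangling e → (G.ends e).card = 1) ∧ (¬ G.dangling e → (G.ends e).card = 2)

end TensorNetwork

/-- Rooted binary trees with leaves labelled by single vertices. -/
inductive ContractionTree (V : Type*) where
  | leaf (v : V) : ContractionTree V
  | node (l r : ContractionTree V) : ContractionTree V

namespace ContractionTree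

variable {V : Type*}

open Classical in
/-- The set of vertices that the root of the tree represents. -/
noncomputable def verts : ContractionTree V → Finset V
  | leaf v => {v}
  | node l r => l.verts ∪ r.verts

/-- The contractions performed by the tree. -/
noncomputable def contractions : ContractionTree V → List (Finset V × Finset V)
  | leaf _ => []
  | node l r => (l.verts, r.verts) :: (l.contractions ++ r.contractions)

/-- `(A, B)` is a contraction of the tree; the two operands are unordered. -/
def HasContraction (T : ContractionTree V) (A B : Finset V) : Prop :=
  (A, B) ∈ T.contractions ∨ (B, A) ∈ T.contractions

/-- `T` fully contracts a network with vertex set `V`: the operands of each contraction are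
disjoint, and the root represents all of `V`. -/
def IsFull [Fintype V] (T : ContractionTree V) : Prop :=
  (∀ p ∈ T.contractions, Disjoint p.1 p.2) ∧ T.verts = Finset.univ

/-- Total cost: the sum of `exp (cost_G(A, B))` over all contractions `(A, B)` of the tree. -/
noncomputable def cost {E : Type*} [Fintype V] [Fintype E] (G : TensorNetwork V E)
    (T : ContractionTree V) : ℝ :=
  (T.contractions.map fun p => Real.exp (G.logCost p.1 p.2)).sum

/-- `T`, on data vertices `VD` and embedding vertices `VE`, is constrained on the data contraction
tree `T₀`.  Here `A.toLeft` is the intersection of `A` with the data vertices. -/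
def IsConstrainedOn {VD VE : Type*} (T : ContractionTree (VD ⊕ VE)) (T₀ : ContractionTree VD) :
    Prop :=
  ∀ A B : Finset VD, T₀.HasContraction A B →
    ∃ A' B' : Finset (VD ⊕ VE), T.HasContraction A' B' ∧ A'.toLeft = A ∧ B'.toLeft = B

end ContractionTree

section Sketching

variable {VD VE ι P F : Type*}

/-- The overall network `(G_D, G_E)`.  The type `ι` indexes the edges to be sketched; they occur as
dangling edges in the data network and in the embedding and become contracted edges here.  `P`
indexes the remaining data edges, `F` the remaining embedding edges. -/
def glue (D : TensorNetwork VD (ι ⊕ P)) (S : TensorNetwork VE (ι ⊕ F)) :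
    TensorNetwork (VD ⊕ VE) (ι ⊕ (P ⊕ F)) where
  ends
    | .inl i => (D.ends (.inl i)).disjSum (S.ends (.inl i))
    | .inr (.inl p) => (D.ends (.inr p)).disjSum ∅
    | .inr (.inr f) => (∅ : Finset VD).disjSum (S.ends (.inr f))
  dangling
    | .inl _ => False
    | .inr (.inl p) => D.dangling (.inr p)
    | .inr (.inr f) => S.dangling (.inr f)
  dim
    | .inl i => D.dim (.inl i)
    | .inr (.inl p) => D.dim (.inr p)
    | .inr (.inr f) => S.dim (.inr f)
  ends_nonempty := by
    rintro (i | p | f)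
    · have := (D.ends_nonempty (.inl i)).card_pos
      rw [← Finset.card_pos, Finset.card_disjSum]
      omega
    · have := (D.ends_nonempty (.inr p)).card_pos
      rw [← Finset.card_pos, Finset.card_disjSum]
      omega
    · have := (S.ends_nonempty (.inr f)).card_pos
      rw [← Finset.card_pos, Finset.card_disjSum]
      omega
  two_le_of_contracted := by
    rintro (i | p | f) h
    · have h1 := (D.ends_nonempty (.inl i)).card_pos
      have h2 := (S.ends_nonempty (.inl i)).card_pos
      rw [Finset.card_disjSum]
      omega
    · have := D.two_le_of_contracted (.inr p) h
      rw [Finset.card_disjSum]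
      omega
    · have := S.two_le_of_contracted (.inr f) h
      rw [Finset.card_disjSum]
      omega

/-- `S` is a (graph) embedding for the data `D`: it can be attached to `D` along the edges to be
sketched. -/
def IsEmbeddingFor (D : TensorNetwork VD (ι ⊕ P)) (S : TensorNetwork VE (ι ⊕ F)) : Prop :=
  S.IsGraph ∧ ∀ i, S.dangling (.inl i) ∧ S.dim (.inl i) = D.dim (.inl i)

/-- The only uncontracted embedding edge, other than the edges to be sketched, is one edge of
size `m`. -/
def HasSingleOutput (S : TensorNetwork VE (ι ⊕ F)) (m : ℕ+) : Prop :=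
  ∃ o : F, S.dim (.inr o) = m ∧ ∀ f, S.dangling (.inr f) ↔ f = o

open Classical in
/-- Row size of the matricization of the tensor at `v` in the linearization of the embedding given
by the vertex ordering `σ`: the rows collect the output dimensions at `v` and the dimensions shared
with later embedding vertices (the edges to be sketched belong to the columns). -/
noncomputable def rowSize [Fintype VE] [Fintype F] (S : TensorNetwork VE (ι ⊕ F))
    (σ : VE ≃ Fin (Fintype.card VE)) (v : VE) : ℕ :=
  ∏ f : F with v ∈ S.ends (.inr f) ∧
    (S.dangling (.inr f) ∨ ∃ x ∈ S.ends (.inr f), σ v < σ x), (S.dim (.inr f) : ℕ)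

/-- `N_E log(1/δ) / ε²`, with `N_E = k` embedding vertices. -/
noncomputable def accuracyScale (k : ℕ) (ε δ : ℝ) : ℝ := k * Real.log (1 / δ) / ε ^ 2

/-- The `(ε, δ)`-accurate sufficient condition, with the constant `c₀` in the `Ω`: in some
linearization every row size is at least `c₀ N_E log(1/δ) / ε²`. -/
def SufficientCondition [Fintype VE] [Fintype F] (c₀ ε δ : ℝ) (S : TensorNetwork VE (ι ⊕ F)) :
    Prop :=
  ∃ σ : VE ≃ Fin (Fintype.card VE), ∀ v : VE,
    c₀ * accuracyScale (Fintype.card VE) ε δ ≤ rowSize S σ v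

/-- The class of embeddings for `D` that satisfy the `(ε, δ)`-accurate sufficient condition and
have only one output sketch dimension, of size `m = Θ(N_E log(1/δ) / ε²)`.  The implied constants
are `c₀` (lower) and `C₁` (upper). -/
def Admissible [Fintype VE] [Fintype F] (c₀ C₁ ε δ : ℝ) (m : ℕ+)
    (D : TensorNetwork VD (ι ⊕ P)) (S : TensorNetwork VE (ι ⊕ F)) : Prop :=
  IsEmbeddingFor D S ∧ SufficientCondition c₀ ε δ S ∧ HasSingleOutput S m ∧
    c₀ * accuracyScale (Fintype.card VE) ε δ ≤ ((m : ℕ) : ℝ) ∧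
    ((m : ℕ) : ℝ) ≤ C₁ * accuracyScale (Fintype.card VE) ε δ

/-- `T` is a contraction tree of the whole network constrained on the data tree `T₀`. -/
def IsSketchingTree [Fintype VD] [Fintype VE] (T₀ : ContractionTree VD)
    (T : ContractionTree (VD ⊕ VE)) : Prop :=
  T.IsFull ∧ T.IsConstrainedOn T₀

end Sketching

/-- Tensor train of order `n + 1`, with all output dimensions of size `s` and rank `R`.  The edges
to be sketched are the output dimensions of all cores but the last; the other edges are the `n`
bonds and the output dimension of the last core. -/
def ttData (n : ℕ) (s R : ℕ+) : TensorNetwork (Fin (n + 1)) (Fin n ⊕ (Fin n ⊕ Unit)) where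
  ends
    | .inl j => {j.castSucc}
    | .inr (.inl j) => {j.castSucc, j.succ}
    | .inr (.inr _) => {Fin.last n}
  dangling
    | .inl _ => True
    | .inr (.inl _) => False
    | .inr (.inr _) => True
  dim
    | .inl _ => s
    | .inr (.inl _) => R
    | .inr (.inr _) => s
  ends_nonempty := by rintro (j | j | j) <;> simp
  two_le_of_contracted := by
    rintro (j | j | j) h
    · exact absurd trivial h
    · rw [Finset.card_pair (Fin.castSucc_lt_succ).ne]
    · exact absurd trivial h

/-- The left-to-right data contraction tree `((v₁, v₂), v₃), …, v_{n+1})`. -/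
def leftToRight (n : ℕ) : ContractionTree (Fin (n + 1)) :=
  (List.finRange n).foldl (fun t j => .node t (.leaf j.succ)) (.leaf 0)

/-- Tensor train embedding with `n` cores and rank `m`.  Embedding edge `j` joins the cores `j` and
`j + 1`, except for the last one, which is the output dimension of the last core. -/
def ttEmbedding (n : ℕ) (s m : ℕ+) : TensorNetwork (Fin n) (Fin n ⊕ Fin n) where
  ends
    | .inl j => {j}
    | .inr j => {x | x = j ∨ (x : ℕ) = j + 1}
  dangling
    | .inl _ => True
    | .inr j => (j : ℕ) + 1 = n
  dim
    | .inl _ => s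
    | .inr _ => m
  ends_nonempty := by
    rintro (j | j)
    · simp
    · exact ⟨j, by simp⟩
  two_le_of_contracted := by
    rintro (j | j) h
    · exact absurd trivial h
    · have hj : (j : ℕ) + 1 < n := lt_of_le_of_ne j.2 h
      refine Finset.one_lt_card.2 ⟨j, by simp, ⟨j + 1, hj⟩, by simp, ?_⟩
      simp [Fin.ext_iff]

/-- The contraction order of the randomized sketching step of "Randomize-then-Orthogonalize": the
running tensor is contracted alternately with the next embedding core and the next data core, that
is, in the order `v₁, u₁, v₂, u₂, …, v_n, u_n, v_{n+1}`. -/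
def rtoTree (n : ℕ) : ContractionTree (Fin (n + 1) ⊕ Fin n) :=
  (List.finRange n).foldl
    (fun t j => .node (.node t (.leaf (.inr j))) (.leaf (.inl j.succ))) (.leaf (.inl 0))

/-- Cost of that sketching step. -/
noncomputable def rtoCost (n : ℕ) (s R m : ℕ+) : ℝ :=
  (rtoTree n).cost (glue (ttData n s R) (ttEmbedding n s m))

/-- `N s R² m` for order `N = n + 1`. -/
noncomputable def ttRate (n : ℕ) (s R m : ℕ+) : ℝ :=
  ((n : ℝ) + 1) * ((s : ℕ) : ℝ) * ((R : ℕ) : ℝ) ^ 2 * ((m : ℕ) : ℝ)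

end TNSketch

/-!
For disjoint `A` and `B` the contraction `(A, B)` costs the product of the dimensions of the edges
leaving `A` or `B`, so any sets of such edges give lower bounds and any list containing all of them
gives an upper bound.

Lower bound. Since the tree is constrained on the left-to-right tree, for every interior data core
`k` some contraction has an operand whose only data core is `k` and another whose data cores all
precede `k`. Splitting the operand containing `k` further if necessary, one may assume that the
embedding vertex at the sketched edge of `k` lies outside it. The sketched edge and both bonds of
`k` then leave this operand, and contribute `s * R ^ 2`. The other operand either contains an
embedding vertex, and the one that comes last in the linearization has its whole row leaving the
operand, or consists of data cores only, and one of their sketched edges leaves it. This gives a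
further factor of order `m`. As `k` is the largest data core involved, the contractions found for
different `k` are distinct, and summing over `k` yields the bound.

Upper bound. Two contractions absorb each pair of an embedding core and the next data core, and each
of them costs at most `s * R ^ 2 * m`.
-/

namespace TNSketch

namespace TensorNetwork

variable {V E : Type*}

lemma exp_weight (G : TensorNetwork V E) (e : E) : Real.exp (G.weight e) = (G.dim e : ℕ) :=
  Real.exp_log (mod_cast (G.dim e).pos)

variable [Fintype E]

lemma mem_edgesBetween {G : TensorNetwork V E} {A B : Finset V} {e : E} :
    e ∈ G.edgesBetween A B ↔ (∃ a ∈ A, a ∈ G.ends e) ∧ ∃ b ∈ B, b ∈ G.ends e := by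
  simp [edgesBetween]

variable [Fintype V]

lemma mem_edgesOut {G : TensorNetwork V E} {A : Finset V} {e : E} :
    e ∈ G.edgesOut A ↔ (∃ a ∈ A, a ∈ G.ends e) ∧ (G.dangling e ∨ ∃ b ∉ A, b ∈ G.ends e) := by
  obtain ⟨_, _⟩ := G.ends_nonempty e
  simp only [edgesOut, edgesOpen, Finset.mem_union, mem_edgesBetween, Finset.mem_compl,
    Finset.mem_filter_univ, Finset.subset_iff]
  grind

lemma mem_edgesOut_singleton {G : TensorNetwork V E} {v : V} {e : E} :
    e ∈ G.edgesOut {v} ↔ v ∈ G.ends e := by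
  simp only [mem_edgesOut, Finset.mem_singleton, exists_eq_left, and_iff_left_iff_imp]
  intro _
  by_cases he : G.dangling e
  · exact .inl he
  · obtain ⟨b, hb, hbv⟩ := Finset.exists_mem_ne (G.two_le_of_contracted e he) v
    exact .inr ⟨b, hbv, hb⟩

lemma edgesOut_inter_edgesOut [DecidableEq E] (G : TensorNetwork V E) {A B : Finset V}
    (h : Disjoint A B) : G.edgesOut A ∩ G.edgesOut B = G.edgesBetween A B := by
  ext e
  simp only [Finset.mem_inter, mem_edgesOut, mem_edgesBetween]
  have hA : ∀ a ∈ A, a ∉ B := fun _ ha => Finset.disjoint_left.1 h ha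
  grind

-- An edge joining `A` to `B` is counted by both cuts, and subtracted once.
lemma logCost_eq_sum_weight [DecidableEq E] (G : TensorNetwork V E) {A B : Finset V}
    (h : Disjoint A B) : G.logCost A B = ∑ e ∈ G.edgesOut A ∪ G.edgesOut B, G.weight e := by
  rw [logCost, cut, cut, cutBetween, ← G.edgesOut_inter_edgesOut h, ← Finset.sum_union_inter,
    add_sub_cancel_right]

lemma logCost_comm (G : TensorNetwork V E) (A B : Finset V) : G.logCost A B = G.logCost B A := by
  have h : G.edgesBetween A B = G.edgesBetween B A := by
    ext e
    rw [mem_edgesBetween, mem_edgesBetween, and_comm]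
  rw [logCost, logCost, cutBetween, cutBetween, h, add_comm]

lemma exp_logCost [DecidableEq E] (G : TensorNetwork V E) {A B : Finset V} (h : Disjoint A B) :
    Real.exp (G.logCost A B) = (∏ e ∈ G.edgesOut A ∪ G.edgesOut B, (G.dim e : ℕ) : ℕ) := by
  rw [G.logCost_eq_sum_weight h, Real.exp_sum, Nat.cast_prod]
  exact Finset.prod_congr rfl fun e _ => G.exp_weight e

lemma prod_dim_mul_prod_dim_le_exp_logCost (G : TensorNetwork V E) {A B : Finset V}
    {P Q : Finset E} (h : Disjoint A B) (hP : P ⊆ G.edgesOut A) (hQ : Q ⊆ G.edgesOut B)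
    (hPQ : Disjoint P Q) :
    ((∏ e ∈ P, (G.dim e : ℕ) : ℕ) : ℝ) * (∏ e ∈ Q, (G.dim e : ℕ) : ℕ) ≤
      Real.exp (G.logCost A B) := by
  classical
  rw [G.exp_logCost h, ← Nat.cast_mul, ← Finset.prod_union hPQ, Nat.cast_le]
  exact Nat.le_of_dvd (Finset.prod_pos fun e _ => (G.dim e).pos)
    (Finset.prod_dvd_prod_of_subset _ _ _ (Finset.union_subset_union hP hQ))

lemma exp_logCost_le_prod_dim (G : TensorNetwork V E) {A B : Finset V} {L : Multiset E}
    (h : Disjoint A B) (hA : ∀ e ∈ G.edgesOut A, e ∈ L) (hB : ∀ e ∈ G.edgesOut B, e ∈ L) :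
    Real.exp (G.logCost A B) ≤ ((L.map fun e => (G.dim e : ℕ)).prod : ℕ) := by
  classical
  rw [G.exp_logCost h, Nat.cast_le]
  have hle : (G.edgesOut A ∪ G.edgesOut B).val ≤ L :=
    (Multiset.le_iff_subset (Finset.nodup _)).2 fun e he =>
      (Finset.mem_union.1 he).elim (hA e) (hB e)
  refine Nat.le_of_dvd (Multiset.prod_pos fun d hd => ?_)
    (Multiset.prod_dvd_prod_of_le (Multiset.map_le_map hle))
  obtain ⟨e, -, rfl⟩ := Multiset.mem_map.1 hd
  exact (G.dim e).pos

end TensorNetwork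

namespace ContractionTree

variable {V : Type*}

lemma hasContraction_node {l r : ContractionTree V} {A B : Finset V} :
    (node l r).HasContraction A B ↔
      ((A = l.verts ∧ B = r.verts) ∨ (A = r.verts ∧ B = l.verts)) ∨
        l.HasContraction A B ∨ r.HasContraction A B := by
  simp only [HasContraction, contractions, List.mem_cons, List.mem_append, Prod.mk.injEq]
  tauto

lemma exists_hasContraction_of_mem_verts {T : ContractionTree V} {a b : V} (hab : a ≠ b)
    (ha : a ∈ T.verts) (hb : b ∈ T.verts) :
    ∃ X Y, T.HasContraction X Y ∧ a ∈ X ∧ b ∈ Y ∧ X ⊆ T.verts ∧ Y ⊆ T.verts := by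
  induction T with
  | leaf v =>
    simp only [verts, Finset.mem_singleton] at ha hb
    exact absurd (ha.trans hb.symm) hab
  | node l r ihl ihr =>
    have hl : l.verts ⊆ (node l r).verts := by simp [verts]
    have hr : r.verts ⊆ (node l r).verts := by simp [verts]
    simp only [verts, Finset.mem_union] at ha hb
    rcases ha with ha | ha <;> rcases hb with hb | hb
    · obtain ⟨X, Y, h, haX, hbY, hX, hY⟩ := ihl ha hb
      exact ⟨X, Y, hasContraction_node.2 (.inr (.inl h)), haX, hbY, hX.trans hl, hY.trans hl⟩
    · exact ⟨_, _, hasContraction_node.2 (.inl (.inl ⟨rfl, rfl⟩)), ha, hb, hl, hr⟩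
    · exact ⟨_, _, hasContraction_node.2 (.inl (.inr ⟨rfl, rfl⟩)), ha, hb, hr, hl⟩
    · obtain ⟨X, Y, h, haX, hbY, hX, hY⟩ := ihr ha hb
      exact ⟨X, Y, hasContraction_node.2 (.inr (.inr h)), haX, hbY, hX.trans hr, hY.trans hr⟩

lemma HasContraction.exists_hasContraction_of_mem {T : ContractionTree V} {A B : Finset V}
    (h : T.HasContraction A B) {a b : V} (hab : a ≠ b) (ha : a ∈ B) (hb : b ∈ B) :
    ∃ X Y, T.HasContraction X Y ∧ a ∈ X ∧ b ∈ Y ∧ X ⊆ B ∧ Y ⊆ B := by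
  induction T with
  | leaf v => simp [HasContraction, contractions] at h
  | node l r ihl ihr =>
    rcases hasContraction_node.1 h with (⟨-, rfl⟩ | ⟨-, rfl⟩) | h | h
    · obtain ⟨X, Y, h, hXY⟩ := exists_hasContraction_of_mem_verts hab ha hb
      exact ⟨X, Y, hasContraction_node.2 (.inr (.inr h)), hXY⟩
    · obtain ⟨X, Y, h, hXY⟩ := exists_hasContraction_of_mem_verts hab ha hb
      exact ⟨X, Y, hasContraction_node.2 (.inr (.inl h)), hXY⟩
    · obtain ⟨X, Y, h, hXY⟩ := ihl h
      exact ⟨X, Y, hasContraction_node.2 (.inr (.inl h)), hXY⟩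
    · obtain ⟨X, Y, h, hXY⟩ := ihr h
      exact ⟨X, Y, hasContraction_node.2 (.inr (.inr h)), hXY⟩

lemma HasContraction.disjoint [Fintype V] {T : ContractionTree V} {A B : Finset V}
    (h : T.HasContraction A B) (hT : T.IsFull) : Disjoint A B :=
  h.elim (hT.1 _) fun h => (hT.1 _ h).symm

lemma isConstrainedOn_of_forall_mem_contractions {VD VE : Type*}
    {T : ContractionTree (VD ⊕ VE)} {T₀ : ContractionTree VD}
    (h : ∀ p ∈ T₀.contractions, ∃ q ∈ T.contractions, q.1.toLeft = p.1 ∧ q.2.toLeft = p.2) :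
    T.IsConstrainedOn T₀ := by
  rintro A B (hAB | hBA)
  · obtain ⟨q, hq, hA, hB⟩ := h _ hAB
    exact ⟨q.1, q.2, .inl hq, hA, hB⟩
  · obtain ⟨q, hq, hB, hA⟩ := h _ hBA
    exact ⟨q.2, q.1, .inr hq, hA, hB⟩

lemma card_mul_le_cost {E α : Type*} [Fintype V] [Fintype E] [Fintype α] (G : TensorNetwork V E)
    {T : ContractionTree V} {p : α → Finset V × Finset V} {c : ℝ} (hinj : Function.Injective p)
    (hp : ∀ a, p a ∈ T.contractions) (hc : ∀ a, c ≤ Real.exp (G.logCost (p a).1 (p a).2)) :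
    Fintype.card α * c ≤ T.cost G := by
  obtain ⟨l, hl, hsub⟩ : (Finset.univ.toList.map p).Subperm T.contractions := by
    refine List.Nodup.subperm ((Finset.nodup_toList _).map hinj) fun q hq => ?_
    obtain ⟨a, -, rfl⟩ := List.mem_map.1 hq
    exact hp a
  calc Fintype.card α * c = ∑ _a : α, c := by simp
    _ ≤ ∑ a, Real.exp (G.logCost (p a).1 (p a).2) := Finset.sum_le_sum fun a _ => hc a
    _ = (l.map fun q => Real.exp (G.logCost q.1 q.2)).sum := by
        rw [(hl.map _).sum_eq, List.map_map, ← Finset.sum_map_toList]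
        rfl
    _ ≤ T.cost G := by
        refine (hsub.map _).sum_le_sum fun x hx => ?_
        obtain ⟨q, -, rfl⟩ := List.mem_map.1 hx
        exact (Real.exp_pos _).le

lemma verts_and_contractions_foldl_finRange {n : ℕ}
    (step : ContractionTree V → Fin n → ContractionTree V) (A : Fin (n + 1) → Finset V)
    (C : Fin n → List (Finset V × Finset V))
    (hstep : ∀ t j, t.verts = A j.castSucc →
      (step t j).verts = A j.succ ∧ (step t j).contractions.Perm (C j ++ t.contractions))
    (t : ContractionTree V) (ht : t.verts = A 0) :
    ((List.finRange n).foldl step t).verts = A (Fin.last n) ∧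
      ((List.finRange n).foldl step t).contractions.Perm
        ((List.finRange n).flatMap C ++ t.contractions) := by
  induction n generalizing t with
  | zero => exact ⟨ht, .refl _⟩
  | succ n ih =>
    obtain ⟨hverts, hperm⟩ := hstep t 0 ht
    obtain ⟨hverts', hperm'⟩ := ih (fun t j => step t j.succ) (fun k => A k.succ)
      (fun j => C j.succ) (fun t j => hstep t j.succ) (step t 0) hverts
    rw [List.finRange_succ, List.foldl_cons, List.foldl_map, List.flatMap_cons, List.flatMap_map]
    refine ⟨hverts', hperm'.trans ((hperm.append_left _).trans ?_)⟩
    rw [← List.append_assoc]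
    exact List.perm_append_comm.append_right _

end ContractionTree

lemma contractions_leftToRight (n : ℕ) :
    (leftToRight n).contractions.Perm
      ((List.finRange n).map fun j => (Finset.Iic j.castSucc, {j.succ})) := by
  have h := (ContractionTree.verts_and_contractions_foldl_finRange
    (fun t (j : Fin n) => .node t (.leaf j.succ)) Finset.Iic
    (fun j => [(Finset.Iic j.castSucc, {j.succ})]) (fun t j ht => ⟨?_, ?_⟩)
    (.leaf 0) ?_).2
  · rw [List.map_eq_flatMap]
    simpa only [leftToRight, ContractionTree.contractions, List.append_nil] using h
  · ext x
    simp only [ContractionTree.verts, ht, Finset.union_singleton, Finset.mem_insert, Fin.ext_iff,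
      Fin.val_succ, Finset.mem_Iic, ← Fin.val_fin_le, Fin.val_castSucc]
    omega
  · simp [ContractionTree.contractions, ContractionTree.verts, ht]
  · ext x
    simp [ContractionTree.verts]

section LowerBound

open TensorNetwork

variable {VD VE ι P F : Type*} {n : ℕ} {s R : ℕ+}

/-- The three edges at the interior core `j + 1` of a tensor train of order `n + 2`, as edges of
the overall network: its output edge and its two bonds. -/
def coreEdges (F : Type*) (j : Fin n) : Finset (Fin (n + 1) ⊕ ((Fin (n + 1) ⊕ Unit) ⊕ F)) :=
  Finset.disjSum {j.succ} (Finset.disjSum (Finset.disjSum {j.castSucc, j.succ} ∅) ∅)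

lemma prod_dim_coreEdges (S : TensorNetwork VE (Fin (n + 1) ⊕ F)) (j : Fin n) :
    ∏ e ∈ coreEdges F j, ((glue (ttData (n + 1) s R) S).dim e : ℕ) = s * R ^ 2 := by
  simp only [coreEdges, Finset.prod_disjSum, Finset.prod_singleton, Finset.prod_empty, mul_one,
    Finset.prod_pair (Fin.castSucc_lt_succ (i := j)).ne, sq]
  rfl

variable [Fintype VD] [Fintype VE] [Fintype ι] [Fintype P] [Fintype F]

open Classical in
/-- The embedding edges whose dimensions make up `rowSize S σ v`. -/
noncomputable def rowEdges (S : TensorNetwork VE (ι ⊕ F)) (σ : VE ≃ Fin (Fintype.card VE))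
    (v : VE) : Finset F :=
  {f | v ∈ S.ends (.inr f) ∧ (S.dangling (.inr f) ∨ ∃ x ∈ S.ends (.inr f), σ v < σ x)}

-- The witness is the vertex of `A` that comes last in the linearization.
lemma exists_rowEdges_subset_edgesOut (D : TensorNetwork VD (ι ⊕ P)) (S : TensorNetwork VE (ι ⊕ F))
    (σ : VE ≃ Fin (Fintype.card VE)) {A : Finset (VD ⊕ VE)} (hA : A.toRight.Nonempty) :
    ∃ v, (∅ : Finset ι).disjSum ((∅ : Finset P).disjSum (rowEdges S σ v)) ⊆
      (glue D S).edgesOut A := by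
  obtain ⟨v, hv, hlast⟩ := A.toRight.exists_max_image σ hA
  rw [Finset.mem_toRight] at hv
  refine ⟨v, ?_⟩
  rintro (i | p | f) hf
  · simp at hf
  · simp at hf
  obtain ⟨hvf, hf⟩ : v ∈ S.ends (.inr f) ∧
      (S.dangling (.inr f) ∨ ∃ x ∈ S.ends (.inr f), σ v < σ x) := by simpa [rowEdges] using hf
  refine mem_edgesOut.2 ⟨⟨.inr v, hv, Finset.inr_mem_disjSum.2 hvf⟩, hf.imp id ?_⟩
  rintro ⟨x, hxf, hvx⟩
  exact ⟨.inr x, fun hx => (hlast x (Finset.mem_toRight.2 hx)).not_gt hvx,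
    Finset.inr_mem_disjSum.2 hxf⟩

lemma coreEdges_subset_edgesOut {S : TensorNetwork VE (Fin (n + 1) ⊕ F)} {j : Fin n}
    {A : Finset (Fin (n + 2) ⊕ VE)} (hA : A.toLeft = {j.succ.castSucc}) {w : VE}
    (hw : w ∈ S.ends (.inl j.succ)) (hwA : .inr w ∉ A) :
    coreEdges F j ⊆ (glue (ttData (n + 1) s R) S).edgesOut A := by
  have hmem : ∀ y, .inl y ∈ A ↔ y = j.succ.castSucc := fun y => by
    rw [← Finset.mem_toLeft, hA, Finset.mem_singleton]
  have hcore : .inl j.succ.castSucc ∈ A := (hmem _).2 rfl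
  intro e he
  obtain rfl | rfl | rfl : e = .inl j.succ ∨ e = .inr (.inl (.inl j.castSucc)) ∨
      e = .inr (.inl (.inl j.succ)) := by
    revert he
    rcases e with i | (i | i) | f <;> simp [coreEdges]
  · exact mem_edgesOut.2 ⟨⟨_, hcore, by simp [glue, ttData]⟩,
      .inr ⟨.inr w, hwA, by simp [glue, hw]⟩⟩
  · exact mem_edgesOut.2 ⟨⟨_, hcore, by simp [glue, ttData]⟩,
      .inr ⟨.inl j.castSucc.castSucc, by simp [hmem, Fin.ext_iff], by simp [glue, ttData]⟩⟩
  · exact mem_edgesOut.2 ⟨⟨_, hcore, by simp [glue, ttData]⟩,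
      .inr ⟨.inl j.succ.succ, by simp [hmem, Fin.ext_iff], by simp [glue, ttData]⟩⟩

lemma exists_disjoint_coreEdges_le_prod_dim {S : TensorNetwork VE (Fin (n + 1) ⊕ F)}
    {σ : VE ≃ Fin (Fintype.card VE)} {x : ℝ} (hxs : x ≤ (s : ℕ)) (hrow : ∀ v, x ≤ rowSize S σ v)
    {j : Fin n} {B : Finset (Fin (n + 2) ⊕ VE)} (hB : B.Nonempty)
    (hlt : ∀ y ∈ B.toLeft, y < j.succ.castSucc) :
    ∃ Q ⊆ (glue (ttData (n + 1) s R) S).edgesOut B, Disjoint (coreEdges F j) Q ∧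
      x ≤ (∏ e ∈ Q, ((glue (ttData (n + 1) s R) S).dim e : ℕ) : ℕ) := by
  rcases B.toRight.eq_empty_or_nonempty with hBE | hBE
  · obtain ⟨k, hkB, hkj⟩ : ∃ k : Fin (n + 1), .inl k.castSucc ∈ B ∧ k < j.succ := by
      obtain ⟨y | v, hy⟩ := hB
      · have hyj := hlt y (Finset.mem_toLeft.2 hy)
        obtain ⟨k, rfl⟩ := Fin.exists_castSucc_eq.2 (hyj.trans (Fin.castSucc_lt_last _)).ne
        exact ⟨k, hy, hyj⟩
      · exact absurd (Finset.mem_toRight.2 hy) (by simp [hBE])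
    obtain ⟨w, hw⟩ := S.ends_nonempty (.inl k)
    have hwB : .inr w ∉ B := fun h => absurd (Finset.mem_toRight.2 h) (by simp [hBE])
    refine ⟨{.inl k}, ?_, ?_, ?_⟩
    · rw [Finset.singleton_subset_iff, mem_edgesOut]
      exact ⟨⟨_, hkB, by simp [glue, ttData]⟩, .inr ⟨.inr w, hwB, by simp [glue, hw]⟩⟩
    · simp [coreEdges, hkj.ne]
    · simpa [glue, ttData] using hxs
  · obtain ⟨v, hv⟩ := exists_rowEdges_subset_edgesOut (ttData (n + 1) s R) S σ hBE
    refine ⟨_, hv, ?_, ?_⟩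
    · rw [Finset.disjoint_left]
      rintro (i | (i | i) | f) <;> simp [coreEdges]
    · rw [Finset.prod_disjSum, Finset.prod_disjSum, Finset.prod_empty, Finset.prod_empty, one_mul,
        one_mul]
      exact hrow v

lemma exists_hasContraction_toLeft_eq_singleton {T : ContractionTree (Fin (n + 1) ⊕ VE)}
    (hT : IsSketchingTree (leftToRight n) T) (j : Fin n) (w : VE) :
    ∃ A B, T.HasContraction A B ∧ A.toLeft = {j.succ} ∧ .inr w ∉ A ∧ B.Nonempty ∧
      ∀ y ∈ B.toLeft, y < j.succ := by
  obtain ⟨A, B, hAB, hA, hB⟩ := hT.2 (Finset.Iic j.castSucc) {j.succ}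
    (.inl ((contractions_leftToRight n).mem_iff.2 (List.mem_map.2 ⟨j, List.mem_finRange j, rfl⟩)))
  have hmem : ∀ y, .inl y ∈ B ↔ y = j.succ := fun y => by
    rw [← Finset.mem_toLeft, hB, Finset.mem_singleton]
  by_cases hw : .inr w ∈ B
  · obtain ⟨X, Y, hXY, hX, hY, hXB, hYB⟩ :=
      hAB.exists_hasContraction_of_mem Sum.inl_ne_inr ((hmem j.succ).2 rfl) hw
    have hdisj := Finset.disjoint_left.1 (hXY.disjoint hT.1)
    refine ⟨X, Y, hXY, ?_, fun h => hdisj h hY, ⟨_, hY⟩, fun y hy => ?_⟩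
    · ext y
      rw [Finset.mem_toLeft, Finset.mem_singleton]
      exact ⟨fun h => (hmem y).1 (hXB h), fun h => h ▸ hX⟩
    · rw [Finset.mem_toLeft] at hy
      exact absurd hy (((hmem y).1 (hYB hy)) ▸ hdisj hX)
  · refine ⟨B, A, hAB.symm, hB, hw, ⟨.inl 0, ?_⟩, fun y hy => ?_⟩
    · simp [← Finset.mem_toLeft, hA]
    · rw [hA, Finset.mem_Iic] at hy
      exact hy.trans_lt Fin.castSucc_lt_succ

lemma exists_mem_contractions_isGreatest_le_exp_logCost {S : TensorNetwork VE (Fin (n + 1) ⊕ F)}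
    {σ : VE ≃ Fin (Fintype.card VE)} {x : ℝ} (hxs : x ≤ (s : ℕ)) (hrow : ∀ v, x ≤ rowSize S σ v)
    {T : ContractionTree (Fin (n + 2) ⊕ VE)} (hT : IsSketchingTree (leftToRight (n + 1)) T)
    (j : Fin n) :
    ∃ p ∈ T.contractions, IsGreatest (p.1.toLeft ∪ p.2.toLeft : Set (Fin (n + 2)))
        j.succ.castSucc ∧
      (s : ℕ) * (R : ℕ) ^ 2 * x ≤
        Real.exp ((glue (ttData (n + 1) s R) S).logCost p.1 p.2) := by
  obtain ⟨w, hw⟩ := S.ends_nonempty (.inl j.succ)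
  obtain ⟨A, B, hAB, hA, hwA, hB, hlt⟩ :=
    exists_hasContraction_toLeft_eq_singleton hT j.castSucc w
  rw [Fin.succ_castSucc] at hA hlt
  obtain ⟨Q, hQ, hdisj, hxQ⟩ :=
    exists_disjoint_coreEdges_le_prod_dim (R := R) hxs hrow hB hlt
  have hgreatest : IsGreatest (A.toLeft ∪ B.toLeft : Set (Fin (n + 2))) j.succ.castSucc := by
    refine ⟨by simp [hA], ?_⟩
    rintro y (hy | hy)
    · rw [hA] at hy
      exact (Finset.mem_singleton.1 hy).le
    · exact (hlt y hy).le
  have hcost : (s : ℕ) * (R : ℕ) ^ 2 * x ≤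
      Real.exp ((glue (ttData (n + 1) s R) S).logCost A B) := by
    refine le_trans ?_ (prod_dim_mul_prod_dim_le_exp_logCost _ (hAB.disjoint hT.1)
      (coreEdges_subset_edgesOut hA hw hwA) hQ hdisj)
    rw [prod_dim_coreEdges]
    push_cast
    push_cast at hxQ
    gcongr
  rcases hAB with h | h
  · exact ⟨_, h, hgreatest, hcost⟩
  · exact ⟨_, h, by rwa [Set.union_comm], by rwa [logCost_comm]⟩

lemma mul_le_cost_of_le_rowSize {S : TensorNetwork VE (Fin (n + 1) ⊕ F)}
    {σ : VE ≃ Fin (Fintype.card VE)} {x : ℝ} (hxs : x ≤ (s : ℕ)) (hrow : ∀ v, x ≤ rowSize S σ v)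
    {T : ContractionTree (Fin (n + 2) ⊕ VE)} (hT : IsSketchingTree (leftToRight (n + 1)) T) :
    n * ((s : ℕ) * (R : ℕ) ^ 2 * x) ≤ T.cost (glue (ttData (n + 1) s R) S) := by
  choose p hp hgreatest hcost using
    exists_mem_contractions_isGreatest_le_exp_logCost (R := R) hxs hrow hT
  have hinj : Function.Injective p := fun i j hij => by
    have h := (hgreatest i).unique (hij ▸ hgreatest j)
    exact Fin.succ_injective _ (Fin.castSucc_injective _ h)
  simpa only [Fintype.card_fin] using ContractionTree.card_mul_le_cost _ hinj hp hcost

lemma mul_ttRate_le_cost {m : ℕ+} {κ : ℝ} (hκ : 0 ≤ κ) (hn : 2 ≤ n)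
    {S : TensorNetwork VE (Fin n ⊕ F)} {σ : VE ≃ Fin (Fintype.card VE)}
    (hs : κ * (m : ℕ) ≤ (s : ℕ)) (hrow : ∀ v, κ * (m : ℕ) ≤ rowSize S σ v)
    {T : ContractionTree (Fin (n + 1) ⊕ VE)} (hT : IsSketchingTree (leftToRight n) T) :
    κ / 3 * ttRate n s R m ≤ T.cost (glue (ttData n s R) S) := by
  obtain ⟨k, rfl⟩ : ∃ k, n = k + 1 := ⟨n - 1, by omega⟩
  refine le_trans ?_ (mul_le_cost_of_le_rowSize hs hrow hT)
  have hk : ((k + 1 : ℕ) + 1 : ℝ) / 3 ≤ k := by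
    have : (1 : ℝ) ≤ k := mod_cast Nat.le_of_succ_le_succ hn
    push_cast
    linarith
  calc κ / 3 * ttRate (k + 1) s R m
      = ((k + 1 : ℕ) + 1 : ℝ) / 3 * ((s : ℕ) * (R : ℕ) ^ 2 * (κ * (m : ℕ))) := by
        rw [ttRate]
        ring
    _ ≤ k * ((s : ℕ) * (R : ℕ) ^ 2 * (κ * (m : ℕ))) := by gcongr

lemma mul_ttRate_le_cost_of_sufficientCondition {m : ℕ+} {c₀ C₁ ε δ : ℝ} (hc₀ : 0 < c₀)
    (hC₁ : 0 < C₁) (hn : 2 ≤ n) (hms : m ≤ s) {S : TensorNetwork VE (Fin n ⊕ F)}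
    (hS : SufficientCondition c₀ ε δ S)
    (hm : ((m : ℕ) : ℝ) ≤ C₁ * accuracyScale (Fintype.card VE) ε δ)
    {T : ContractionTree (Fin (n + 1) ⊕ VE)} (hT : IsSketchingTree (leftToRight n) T) :
    min (c₀ / C₁) 1 / 3 * ttRate n s R m ≤ T.cost (glue (ttData n s R) S) := by
  obtain ⟨σ, hσ⟩ := hS
  refine mul_ttRate_le_cost (σ := σ) (by positivity) hn ?_ (fun v => ?_) hT
  · calc min (c₀ / C₁) 1 * (m : ℕ) ≤ 1 * ((m : ℕ) : ℝ) := by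
          gcongr
          exact min_le_right _ _
      _ ≤ (s : ℕ) := by simpa using hms
  · calc min (c₀ / C₁) 1 * (m : ℕ) ≤ c₀ / C₁ * (C₁ * accuracyScale (Fintype.card VE) ε δ) := by
          gcongr
          exact min_le_left _ _
      _ = c₀ * accuracyScale (Fintype.card VE) ε δ := by
          field_simp
      _ ≤ rowSize S σ v := hσ v

end LowerBound

section RandomizeThenOrthogonalize

open TensorNetwork

variable {n : ℕ} {s R m : ℕ+}

/-- The vertices of the running tensor of `rtoTree` once the data cores `0, …, a` and the embedding
cores before `b` have been contracted. -/
def rtoRunning (a b : Fin (n + 1)) : Finset (Fin (n + 1) ⊕ Fin n) :=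
  (Finset.Iic a).disjSum {x | x.castSucc < b}

lemma inl_mem_rtoRunning {a b y : Fin (n + 1)} :
    .inl y ∈ rtoRunning a b ↔ (y : ℕ) ≤ a := by
  simp [rtoRunning]

lemma inr_mem_rtoRunning {a b : Fin (n + 1)} {x : Fin n} :
    .inr x ∈ rtoRunning a b ↔ (x : ℕ) < b := by
  simp [rtoRunning, Fin.lt_def]

lemma verts_and_contractions_rtoTree (n : ℕ) :
    (rtoTree n).verts = rtoRunning (Fin.last n) (Fin.last n) ∧
      (rtoTree n).contractions.Perm ((List.finRange n).flatMap fun j =>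
        [(rtoRunning j.castSucc j.succ, {.inl j.succ}),
          (rtoRunning j.castSucc j.castSucc, {.inr j})]) := by
  have hrun : ∀ j : Fin n,
      rtoRunning j.castSucc j.castSucc ∪ {.inr j} = rtoRunning j.castSucc j.succ := by
    intro j
    ext (y | x) <;> simp [inl_mem_rtoRunning, inr_mem_rtoRunning, Fin.ext_iff]
    omega
  have hrun' : ∀ j : Fin n,
      rtoRunning j.castSucc j.succ ∪ {.inl j.succ} = rtoRunning j.succ j.succ := by
    intro j
    ext (y | x) <;> simp [inl_mem_rtoRunning, inr_mem_rtoRunning, Fin.ext_iff]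
    omega
  have h := ContractionTree.verts_and_contractions_foldl_finRange
    (fun t (j : Fin n) => .node (.node t (.leaf (.inr j))) (.leaf (.inl j.succ)))
    (fun k => rtoRunning k k) (fun j => [(rtoRunning j.castSucc j.succ, {.inl j.succ}),
      (rtoRunning j.castSucc j.castSucc, {.inr j})]) (fun t j ht => ⟨?_, ?_⟩) (.leaf (.inl 0)) ?_
  · simpa only [rtoTree, ContractionTree.contractions, List.append_nil] using h
  · simp only [ContractionTree.verts, ht]
    rw [← hrun', ← hrun]
    congr!
  · simp only [ContractionTree.contractions, ContractionTree.verts, ht, ← hrun, List.append_nil]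
    convert List.Perm.refl _
    simp only [List.cons_append, List.nil_append]
    congr!
  · ext (y | x) <;> simp [ContractionTree.verts, inl_mem_rtoRunning, inr_mem_rtoRunning]

lemma mem_contractions_rtoTree {p : Finset (Fin (n + 1) ⊕ Fin n) × Finset (Fin (n + 1) ⊕ Fin n)} :
    p ∈ (rtoTree n).contractions ↔ ∃ j : Fin n,
      p = (rtoRunning j.castSucc j.succ, {.inl j.succ}) ∨
        p = (rtoRunning j.castSucc j.castSucc, {.inr j}) := by
  simp [(verts_and_contractions_rtoTree n).2.mem_iff]

lemma disjoint_of_mem_contractions_rtoTree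
    {p : Finset (Fin (n + 1) ⊕ Fin n) × Finset (Fin (n + 1) ⊕ Fin n)}
    (hp : p ∈ (rtoTree n).contractions) : Disjoint p.1 p.2 := by
  obtain ⟨j, rfl | rfl⟩ := mem_contractions_rtoTree.1 hp <;>
    simp [inl_mem_rtoRunning, inr_mem_rtoRunning]

lemma isSketchingTree_rtoTree (n : ℕ) : IsSketchingTree (leftToRight n) (rtoTree n) := by
  refine ⟨⟨fun p => disjoint_of_mem_contractions_rtoTree, ?_⟩,
    ContractionTree.isConstrainedOn_of_forall_mem_contractions fun p hp => ?_⟩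
  · rw [(verts_and_contractions_rtoTree n).1]
    ext (y | x)
    · simp [inl_mem_rtoRunning, Fin.is_le]
    · simp [inr_mem_rtoRunning]
  · rw [(contractions_leftToRight n).mem_iff, List.mem_map] at hp
    obtain ⟨j, -, rfl⟩ := hp
    refine ⟨_, mem_contractions_rtoTree.2 ⟨j, .inl rfl⟩, ?_, ?_⟩
    · simp [rtoRunning]
    · ext y
      simp

section

variable {a b : Fin (n + 1)} {i : Fin n}

lemma sketchedEdge_mem_edgesOut_rtoRunning :
    .inl i ∈ (glue (ttData n s R) (ttEmbedding n s m)).edgesOut (rtoRunning a b) ↔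
      ((i : ℕ) ≤ a ∨ (i : ℕ) < b) ∧ ((a : ℕ) < i ∨ (b : ℕ) ≤ i) := by
  simp [mem_edgesOut, glue, ttData, ttEmbedding, inl_mem_rtoRunning, inr_mem_rtoRunning,
    -Fin.val_fin_le, -Fin.val_fin_lt]

lemma bond_mem_edgesOut_rtoRunning :
    .inr (.inl (.inl i)) ∈
      (glue (ttData n s R) (ttEmbedding n s m)).edgesOut (rtoRunning a b) ↔ (i : ℕ) = a := by
  simp only [glue, ttData, Finset.disjSum_empty, Finset.empty_disjSum, mem_edgesOut,
    Finset.map_insert, Function.Embedding.inl_apply, Finset.map_singleton, Finset.mem_insert,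
    Finset.mem_singleton, and_or_left, exists_or, ↓existsAndEq, inl_mem_rtoRunning,
    Fin.val_castSucc, and_true, Fin.val_succ, Order.add_one_le_iff, not_le, not_lt, false_or]
  omega

lemma openEdge_mem_edgesOut_rtoRunning {u : Unit} :
    .inr (.inl (.inr u)) ∈
      (glue (ttData n s R) (ttEmbedding n s m)).edgesOut (rtoRunning a b) ↔ (a : ℕ) = n := by
  simp only [glue, ttData, Finset.disjSum_empty, Finset.empty_disjSum, mem_edgesOut,
    Finset.map_singleton, Function.Embedding.inl_apply, Finset.mem_singleton, exists_eq_right,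
    inl_mem_rtoRunning, Fin.val_last, not_le, true_or, and_true]
  omega

lemma embeddingEdge_mem_edgesOut_rtoRunning :
    .inr (.inr i) ∈
      (glue (ttData n s R) (ttEmbedding n s m)).edgesOut (rtoRunning a b) ↔ (i : ℕ) + 1 = b := by
  simp only [glue, ttEmbedding, Finset.disjSum_empty, Finset.empty_disjSum, mem_edgesOut,
    Finset.mem_map, Finset.mem_filter, Finset.mem_univ, true_and, Function.Embedding.inr_apply,
    exists_eq_or_imp, Sum.exists, reduceCtorEq, and_false, exists_false, or_self,
    inr_mem_rtoRunning, Sum.inr.injEq, exists_eq_right, false_or, not_lt]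
  refine ⟨by grind, fun h => ⟨⟨i, by omega, .inl rfl⟩, or_iff_not_imp_left.2 fun hi => ?_⟩⟩
  exact ⟨⟨i + 1, by omega⟩, h.ge, .inr rfl⟩

end

-- At `j = 0` the truncated `j - 1` only makes embedding edge `0` occur twice in the bound.
lemma exp_logCost_rtoRunning_embeddingCore_le (j : Fin n) :
    Real.exp ((glue (ttData n s R) (ttEmbedding n s m)).logCost
      (rtoRunning j.castSucc j.castSucc) {.inr j}) ≤ (s * R * m * m : ℕ) := by
  let L : Multiset (Fin n ⊕ ((Fin n ⊕ Unit) ⊕ Fin n)) :=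
    {.inl j, .inr (.inl (.inl j)), .inr (.inr j), .inr (.inr ⟨j - 1, by omega⟩)}
  refine (exp_logCost_le_prod_dim _ (L := L)
    (disjoint_of_mem_contractions_rtoTree (mem_contractions_rtoTree.2 ⟨j, .inr rfl⟩))
    ?_ ?_).trans_eq ?_
  · rintro (i | (i | u) | i) <;>
      simp [L, sketchedEdge_mem_edgesOut_rtoRunning, bond_mem_edgesOut_rtoRunning,
        openEdge_mem_edgesOut_rtoRunning, embeddingEdge_mem_edgesOut_rtoRunning, Fin.ext_iff] <;>
      omega
  · rintro (i | (i | u) | i) <;>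
      simp [L, mem_edgesOut_singleton, glue, ttData, ttEmbedding, Fin.ext_iff] <;>
      omega
  · simp [L, glue, ttData, ttEmbedding, mul_assoc]

lemma exp_logCost_rtoRunning_dataCore_le (j : Fin n) :
    Real.exp ((glue (ttData n s R) (ttEmbedding n s m)).logCost
      (rtoRunning j.castSucc j.succ) {.inl j.succ}) ≤ (s * R ^ 2 * m : ℕ) := by
  have hdisj := disjoint_of_mem_contractions_rtoTree (mem_contractions_rtoTree.2 ⟨j, .inl rfl⟩)
  have hrun : ∀ e, e ∈ (glue (ttData n s R) (ttEmbedding n s m)).edgesOut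
      (rtoRunning j.castSucc j.succ) → e = .inr (.inl (.inl j)) ∨ e = .inr (.inr j) := by
    rintro (i | (i | u) | i) <;>
      simp [sketchedEdge_mem_edgesOut_rtoRunning, bond_mem_edgesOut_rtoRunning,
        openEdge_mem_edgesOut_rtoRunning, embeddingEdge_mem_edgesOut_rtoRunning, Fin.ext_iff]
    omega
  obtain ⟨o, k, ho, hcore⟩ : ∃ (o : Fin n ⊕ ((Fin n ⊕ Unit) ⊕ Fin n)) (k : Fin n),
      (glue (ttData n s R) (ttEmbedding n s m)).dim o = s ∧
      ∀ e, .inl j.succ ∈ (glue (ttData n s R) (ttEmbedding n s m)).ends e →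
        e = o ∨ e = .inr (.inl (.inl j)) ∨ e = .inr (.inl (.inl k)) := by
    rcases Fin.eq_castSucc_or_eq_last j.succ with ⟨k, hk⟩ | hlast
    · refine ⟨.inl k, k, rfl, ?_⟩
      rintro (i | (i | u) | i) <;> simp [glue, ttData, Fin.ext_iff] at hk ⊢ <;> omega
    · refine ⟨.inr (.inl (.inr ())), j, rfl, ?_⟩
      rintro (i | (i | u) | i) <;> simp [glue, ttData, Fin.ext_iff] at hlast ⊢ <;> omega
  refine (exp_logCost_le_prod_dim _
    (L := {o, .inr (.inl (.inl j)), .inr (.inl (.inl k)), .inr (.inr j)}) hdisj ?_ ?_).trans_eq ?_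
  · intro e he
    have := hrun e he
    simp only [Multiset.insert_eq_cons, Multiset.mem_cons, Multiset.mem_singleton]
    tauto
  · intro e he
    have := hcore e (mem_edgesOut_singleton.1 he)
    simp only [Multiset.insert_eq_cons, Multiset.mem_cons, Multiset.mem_singleton]
    tauto
  · rw [Multiset.insert_eq_cons, Multiset.map_cons, ho]
    simp [glue, ttData, ttEmbedding, sq, mul_assoc]

lemma rtoCost_le (hmR : m ≤ R) : rtoCost n s R m ≤ 2 * ttRate n s R m := by
  have hle : ∀ p ∈ (rtoTree n).contractions,
      Real.exp ((glue (ttData n s R) (ttEmbedding n s m)).logCost p.1 p.2) ≤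
        (s * R ^ 2 * m : ℕ) := by
    intro p hp
    obtain ⟨j, rfl | rfl⟩ := mem_contractions_rtoTree.1 hp
    · exact exp_logCost_rtoRunning_dataCore_le j
    · refine (exp_logCost_rtoRunning_embeddingCore_le j).trans (Nat.cast_le.2 ?_)
      have : (m : ℕ) ≤ R := hmR
      calc (s * R * m * m : ℕ) ≤ s * R * R * m := by gcongr
        _ = s * R ^ 2 * m := by ring
  have hlength : (rtoTree n).contractions.length = 2 * n := by
    rw [(verts_and_contractions_rtoTree n).2.length_eq]
    simp [mul_comm]
  calc rtoCost n s R m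
      ≤ (rtoTree n).contractions.length * ((s * R ^ 2 * m : ℕ) : ℝ) := by
        rw [rtoCost, ContractionTree.cost, ← nsmul_eq_mul]
        refine (List.sum_le_card_nsmul _ _ ?_).trans_eq (by rw [List.length_map])
        rw [List.forall_mem_map]
        exact hle
    _ ≤ 2 * ttRate n s R m := by
        rw [hlength, ttRate]
        push_cast
        have : (0 : ℝ) ≤ (s : ℕ) * (R : ℕ) ^ 2 * (m : ℕ) := by positivity
        linarith

lemma le_rowSize_ttEmbedding (v : Fin n) :
    (m : ℕ) ≤ rowSize (ttEmbedding n s m) (finCongr (Fintype.card_fin n).symm) v := by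
  have hv : v ∈ rowEdges (ttEmbedding n s m) (finCongr (Fintype.card_fin n).symm) v := by
    simp only [rowEdges, Finset.mem_filter, Finset.mem_univ, true_and]
    refine ⟨by simp [ttEmbedding], ?_⟩
    by_cases hlast : (v : ℕ) + 1 = n
    · exact .inl hlast
    · exact .inr ⟨⟨v + 1, by omega⟩, by simp [ttEmbedding], by simp [Fin.lt_def]⟩
  exact Finset.single_le_prod' (f := fun f => ((ttEmbedding n s m).dim (.inr f) : ℕ))
    (fun f _ => PNat.pos _) hv

lemma isGraph_ttEmbedding (n : ℕ) (s m : ℕ+) : (ttEmbedding n s m).IsGraph := by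
  rintro (j | j)
  · exact ⟨fun _ => Finset.card_singleton j, fun h => absurd trivial h⟩
  · refine ⟨fun h => Finset.card_eq_one.2 ⟨j, ?_⟩, fun h => ?_⟩
    · change (j : ℕ) + 1 = n at h
      ext x
      simp [ttEmbedding, Fin.ext_iff, h, x.2.ne]
    · have hj : (j : ℕ) + 1 < n := lt_of_le_of_ne j.2 h
      refine Finset.card_eq_two.2 ⟨j, ⟨j + 1, hj⟩, by simp [Fin.ext_iff], ?_⟩
      ext x
      simp [ttEmbedding, Fin.ext_iff]

lemma admissible_ttEmbedding {c₀ C₁ ε δ : ℝ} (hn : 1 ≤ n)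
    (hlow : c₀ * accuracyScale n ε δ ≤ (m : ℕ)) (hup : (m : ℕ) ≤ C₁ * accuracyScale n ε δ) :
    Admissible c₀ C₁ ε δ m (ttData n s R) (ttEmbedding n s m) := by
  rw [← Fintype.card_fin n] at hlow hup
  refine ⟨⟨isGraph_ttEmbedding n s m, fun i => ⟨trivial, rfl⟩⟩,
    ⟨finCongr (Fintype.card_fin n).symm, fun v => ?_⟩,
    ⟨⟨n - 1, by omega⟩, rfl, fun f => ?_⟩, hlow, hup⟩
  · exact hlow.trans (Nat.cast_le.2 (le_rowSize_ttEmbedding v))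
  · change (f : ℕ) + 1 = n ↔ _
    simp only [Fin.ext_iff]
    omega

lemma ttRate_le_rtoCost (hn : 2 ≤ n) (hms : m ≤ s) : 1 / 3 * ttRate n s R m ≤ rtoCost n s R m :=
  mul_ttRate_le_cost (σ := finCongr (Fintype.card_fin n).symm) zero_le_one hn
    (by simpa using hms) (fun v => by simpa using le_rowSize_ttEmbedding v)
    (isSketchingTree_rtoTree n)

end RandomizeThenOrthogonalize

theorem mainTheorem11_general :
    (∀ c₀ C₁ : ℝ, 0 < c₀ → 0 < C₁ → ∃ c : ℝ, 0 < c ∧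
      ∀ (n : ℕ) (s R m : ℕ+) (ε δ : ℝ), 2 ≤ n → m ≤ s → 0 < ε → 0 < δ →
        ∀ (VE : Type u) (F : Type v) [Fintype VE] [Fintype F]
          (S : TensorNetwork VE (Fin n ⊕ F)), SufficientCondition c₀ ε δ S →
          (m : ℕ) ≤ C₁ * accuracyScale (Fintype.card VE) ε δ →
        ∀ T : ContractionTree (Fin (n + 1) ⊕ VE), IsSketchingTree (leftToRight n) T →
          c * ttRate n s R m ≤ T.cost (glue (ttData n s R) S)) ∧
    (∃ b B : ℝ, 0 < b ∧ 0 < B ∧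
      ∀ (n : ℕ) (s R m : ℕ+), IsSketchingTree (leftToRight n) (rtoTree n) ∧
        (2 ≤ n → m ≤ s → b * ttRate n s R m ≤ rtoCost n s R m) ∧
        (m ≤ R → rtoCost n s R m ≤ B * ttRate n s R m)) ∧
    (∀ (c₀ C₁ : ℝ) (n : ℕ) (s R m : ℕ+) (ε δ : ℝ), 1 ≤ n → 0 < ε → 0 < δ →
        c₀ * accuracyScale n ε δ ≤ (m : ℕ) → (m : ℕ) ≤ C₁ * accuracyScale n ε δ →
        Admissible c₀ C₁ ε δ m (ttData n s R) (ttEmbedding n s m)) ∧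
    (∀ c₀ C₁ : ℝ, 0 < c₀ → 0 < C₁ → ∃ K : ℝ, 0 < K ∧
      ∀ (n : ℕ) (s R m : ℕ+) (ε δ : ℝ), 2 ≤ n → m ≤ R → m ≤ s → 0 < ε → 0 < δ →
        ∀ (VE : Type u) (F : Type v) [Fintype VE] [Fintype F]
          (S : TensorNetwork VE (Fin n ⊕ F)), SufficientCondition c₀ ε δ S →
          (m : ℕ) ≤ C₁ * accuracyScale (Fintype.card VE) ε δ →
        ∀ T : ContractionTree (Fin (n + 1) ⊕ VE), IsSketchingTree (leftToRight n) T →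
          rtoCost n s R m ≤ K * T.cost (glue (ttData n s R) S)) := by
  have hlower : ∀ c₀ C₁ : ℝ, 0 < c₀ → 0 < C₁ → 0 < min (c₀ / C₁) 1 / 3 := by
    intro c₀ C₁ hc₀ hC₁
    positivity
  refine ⟨fun c₀ C₁ hc₀ hC₁ => ⟨_, hlower c₀ C₁ hc₀ hC₁, ?_⟩,
    ⟨1 / 3, 2, by norm_num, by norm_num, fun n s R m =>
      ⟨isSketchingTree_rtoTree n, ttRate_le_rtoCost, rtoCost_le⟩⟩,
    fun c₀ C₁ n s R m ε δ hn _ _ => admissible_ttEmbedding hn,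
    fun c₀ C₁ hc₀ hC₁ => ⟨_, div_pos two_pos (hlower c₀ C₁ hc₀ hC₁), ?_⟩⟩
  · intro n s R m ε δ hn hms _ _ VE F _ _ S hS hm T hT
    exact mul_ttRate_le_cost_of_sufficientCondition hc₀ hC₁ hn hms hS hm hT
  · intro n s R m ε δ hn hmR hms _ _ VE F _ _ S hS hm T hT
    have hpos := hlower c₀ C₁ hc₀ hC₁
    refine (rtoCost_le hmR).trans ?_
    rw [div_mul_eq_mul_div, mul_div_assoc]
    gcongr
    rw [le_div_iff₀' hpos]
    exact mul_ttRate_le_cost_of_sufficientCondition hc₀ hC₁ hn hms hS hm hT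

end TNSketch

open TNSketch in
theorem mainTheorem11 :
    -- lower bound for all admissible embeddings and all constrained contraction trees
    (∀ c₀ C₁ : ℝ, 0 < c₀ → 0 < C₁ → ∃ c : ℝ, 0 < c ∧
      ∀ (n : ℕ) (s R m : ℕ+) (ε δ : ℝ), 2 ≤ n → m < R → R < s →
        0 < ε → ε < 1 → 0 < δ → δ < 1 →
        ∀ (VE : Type u) (F : Type v) [Fintype VE] [Fintype F]
          (S : TensorNetwork VE (Fin n ⊕ F)), Admissible c₀ C₁ ε δ m (ttData n s R) S →
        ∀ T : ContractionTree (Fin (n + 1) ⊕ VE), IsSketchingTree (leftToRight n) T →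
          c * ttRate n s R m ≤ T.cost (glue (ttData n s R) S)) ∧
    -- the Randomize-then-Orthogonalize sketch is constrained on the same tree and costs Θ(N s R² m)
    (∃ b B : ℝ, 0 < b ∧ 0 < B ∧
      ∀ (n : ℕ) (s R m : ℕ+), 2 ≤ n → m < R → R < s →
        IsSketchingTree (leftToRight n) (rtoTree n) ∧
        b * ttRate n s R m ≤ rtoCost n s R m ∧ rtoCost n s R m ≤ B * ttRate n s R m) ∧
    -- its embedding is admissible for every sketch size m = Θ(N_E log(1/δ) / ε²), N_E = n
    (∀ (c₀ C₁ : ℝ) (n : ℕ) (s R m : ℕ+) (ε δ : ℝ), 0 < c₀ → 0 < C₁ → 2 ≤ n → m < R → R < s →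
        0 < ε → ε < 1 → 0 < δ → δ < 1 →
        c₀ * accuracyScale n ε δ ≤ ((m : ℕ) : ℝ) → ((m : ℕ) : ℝ) ≤ C₁ * accuracyScale n ε δ →
        Admissible c₀ C₁ ε δ m (ttData n s R) (ttEmbedding n s m)) ∧
    -- hence it is optimal up to a constant factor among all admissible sketches of size m
    (∀ c₀ C₁ : ℝ, 0 < c₀ → 0 < C₁ → ∃ K : ℝ, 0 < K ∧
      ∀ (n : ℕ) (s R m : ℕ+) (ε δ : ℝ), 2 ≤ n → m < R → R < s →
        0 < ε → ε < 1 → 0 < δ → δ < 1 →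
        ∀ (VE : Type u) (F : Type v) [Fintype VE] [Fintype F]
          (S : TensorNetwork VE (Fin n ⊕ F)), Admissible c₀ C₁ ε δ m (ttData n s R) S →
        ∀ T : ContractionTree (Fin (n + 1) ⊕ VE), IsSketchingTree (leftToRight n) T →
          rtoCost n s R m ≤ K * T.cost (glue (ttData n s R) S)) := by
  obtain ⟨hlower, ⟨b, B, hb, hB, hrto⟩, hadm, hopt⟩ := mainTheorem11_general.{u, v}
  refine ⟨fun c₀ C₁ hc₀ hC₁ => ?_, ⟨b, B, hb, hB, ?_⟩, ?_, fun c₀ C₁ hc₀ hC₁ => ?_⟩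
  · obtain ⟨c, hc, h⟩ := hlower c₀ C₁ hc₀ hC₁
    exact ⟨c, hc, fun n s R m ε δ hn hmR hRs hε _ hδ _ VE F _ _ S hS =>
      h n s R m ε δ hn (hmR.trans hRs).le hε hδ VE F S hS.2.1 hS.2.2.2.2⟩
  · exact fun n s R m hn hmR hRs => ⟨(hrto n s R m).1,
      (hrto n s R m).2.1 hn (hmR.trans hRs).le, (hrto n s R m).2.2 hmR.le⟩
  · exact fun c₀ C₁ n s R m ε δ _ _ hn _ _ hε _ hδ _ =>
      hadm c₀ C₁ n s R m ε δ (one_le_two.trans hn) hε hδ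
  · obtain ⟨K, hK, h⟩ := hopt c₀ C₁ hc₀ hC₁
    exact ⟨K, hK, fun n s R m ε δ hn hmR hRs hε _ hδ _ VE F _ _ S hS =>
      h n s R m ε δ hn hmR.le (hmR.trans hRs).le hε hδ VE F S hS.2.1 hS.2.2.2.2⟩
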